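/- Let $K$ be a field, $n\ge 0$, $R=K[X_1,\dots,X_n]$ with its $\mathbb Z^n$-grading ($\deg X_i=\varepsilon_i$, the $i$-th canonical basis vector), and let $$0\to\bigwedge^n R^n\xrightarrow{\partial}\cdots\xrightarrow{\partial}R^n\xrightarrow{\partial}R\to 0,\qquad \partial(e_{i_1}\wedge\dots\wedge e_{i_j})=\sum_{t}(-1)^{t+1}X_{i_t}\,e_{i_1}\wedge\dots\wedge\widehat{e_{i_t}}\wedge\dots\wedge e_{i_j},$$ be the Koszul complex of $X_1,\dots,X_n$, multigraded by $\deg(e_{i_1}\wedge\dots\wedge e_{i_j})=\varepsilon_{i_1}+\dots+\varepsilon_{i_j}$; it resolves $K=R/(X_1,\dots,X_n)$. For $k\ge 1$ let $M(n,k)=\partial(\bigwedge^k R^n)\subseteq\bigwedge^{k-1}R^n$ be the $k$-th syzygy module of $K$, with the induced $\mathbb Z^n$-grading. A Stanley decomposition of a finitely generated $\mathbb Z^n$-graded $R$-module $M$ is a finite family $(S_i,x_i)_{i\in I}$, where $x_i\in M$ is homogeneous and $S_i=K[X_j : j\in F_i]$ for some $F_i\subseteq\{1,\dots,n\}$, with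 $S_i\cap\operatorname{Ann}x_i=0$ and $M=\bigoplus_{i\in I}S_ix_i$ as a $K$-vector space. Its depth is $\min_{i\in I}|F_i|$, and the multigraded Stanley depth $\operatorname{Stdepth}_n M$ is the maximal depth of a Stanley decomposition of $M$ (with $\operatorname{Stdepth}_n 0=\infty$). Then, for all $n\ge 0$ and $k\ge 1$, $$\operatorname{Stdepth}_n M(n,k)\ \ge\ \left\lfloor\frac{n+k}{2}\right\rfloor .$$ -/

import Mathlib

open scoped ExteriorAlgebra CliffordAlgebra

noncomputable section

namespace StanleyKoszul

section StanleyDepth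

variable {K : Type*} [Field K] {n : ℕ} {M : Type*} [AddCommGroup M] [Module K M]
  [Module (MvPolynomial (Fin n) K) M] [IsScalarTower K (MvPolynomial (Fin n) K) M]

/-- The `K`-subspace `S x` of `M`, where `S = K[X_j : j ∈ s]`. -/
def summand (K : Type*) [Field K] {n : ℕ} {M : Type*} [AddCommGroup M] [Module K M]
    [Module (MvPolynomial (Fin n) K) M] [IsScalarTower K (MvPolynomial (Fin n) K) M]
    (s : Finset (Fin n)) (x : M) : Submodule K M :=
  (MvPolynomial.supported K (s : Set (Fin n))).toSubmodule.map
    ((LinearMap.toSpanSingleton (MvPolynomial (Fin n) K) M x).restrictScalars K)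

/-- A (multigraded) Stanley decomposition of an `R`-module `M`, `R = K[X_1, …, X_n]`, with respect
to a `ℤ^n`-grading `𝓜` of `M`: a finite family `(S_i, x_i)` of subalgebras `S_i` of `R` generated
by subsets of the indeterminates (in the multigraded case these are exactly the graded retracts
of `R`) and homogeneous elements `x_i` of `M` with `S_i ∩ Ann x_i = 0` such that `M` is the
internal direct sum of the subspaces `S_i x_i`. Each `S_i x_i` is spanned by the homogeneous
elements `μ x_i`, `μ` a monomial of `S_i`, so that this is a sum of graded subspaces. -/
structure StanleyDecomposition (𝓜 : (Fin n → ℤ) → Submodule K M) where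
  /-- the number of summands -/
  size : ℕ
  /-- `S_i` is generated by the indeterminates `X_j`, `j ∈ vars i` -/
  vars : Fin size → Finset (Fin n)
  /-- the generators `x_i` -/
  gen : Fin size → M
  homogeneous : ∀ i, ∃ a, gen i ∈ 𝓜 a
  ann_eq_zero : ∀ i, ∀ f ∈ MvPolynomial.supported K (vars i : Set (Fin n)),
    f • gen i = 0 → f = 0
  isInternal : DirectSum.IsInternal fun i => summand K (vars i) (gen i)

/-- The depth of a Stanley decomposition: the least number of indeterminates of one of the
polynomial rings `S_i` (and `∞` for the empty decomposition of the zero module). -/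
def StanleyDecomposition.depth {𝓜 : (Fin n → ℤ) → Submodule K M}
    (D : StanleyDecomposition 𝓜) : ℕ∞ :=
  ⨅ i, ((D.vars i).card : ℕ∞)

/-- The multigraded Stanley depth: the maximal depth of a Stanley decomposition. It is `∞` for
the zero module. -/
def stanleyDepth (𝓜 : (Fin n → ℤ) → Submodule K M) : ℕ∞ :=
  ⨆ D : StanleyDecomposition 𝓜, D.depth

end StanleyDepth

section Koszul

variable (K : Type*) [Field K] (n : ℕ)

/-- The algebra underlying the Koszul complex of `X_1, …, X_n` over `R = K[X_1, …, X_n]`: the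
exterior algebra of `R^n`, whose degree `k` part is `⋀^k R^n`. -/
abbrev KoszulAlgebra : Type _ :=
  ExteriorAlgebra (MvPolynomial (Fin n) K) (Fin n → MvPolynomial (Fin n) K)

/-- The basis vector `e_i` of `R^n`, in the exterior algebra. -/
def koszulGen (i : Fin n) : KoszulAlgebra K n :=
  ExteriorAlgebra.ι (MvPolynomial (Fin n) K) (Pi.single i 1)

/-- The Koszul differential, contraction by the linear form `R^n → R`, `e_i ↦ X_i`:
`∂ (e_{i_1} ∧ … ∧ e_{i_k}) = ∑_j (-1)^(j+1) X_{i_j} e_{i_1} ∧ … ∧ ê_{i_j} ∧ … ∧ e_{i_k}`. -/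
def koszulDifferential :
    KoszulAlgebra K n →ₗ[MvPolynomial (Fin n) K] KoszulAlgebra K n :=
  CliffordAlgebra.contractLeft
    (Fintype.linearCombination (MvPolynomial (Fin n) K) (MvPolynomial.X : Fin n → _))

/-- The component of multidegree `a ∈ ℤ^n` of the Koszul complex, in which `e_i` has the degree
of `X_i`: the `K`-span of the elements `X^c e_{i_1} ∧ … ∧ e_{i_j}` with
`c + ε_{i_1} + … + ε_{i_j} = a`, where `ε_1, …, ε_n` is the canonical basis of `ℤ^n`. -/
def koszulComponent (a : Fin n → ℤ) : Submodule K (KoszulAlgebra K n) :=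
  Submodule.span K {y | ∃ (c : Fin n →₀ ℕ) (l : List (Fin n)),
    (∀ i, ((c i + l.count i : ℕ) : ℤ) = a i) ∧
    y = MvPolynomial.monomial c (1 : K) • (l.map (koszulGen K n)).prod}

/-- The `k`-th syzygy module `M(n,k)`, `k ≥ 1`, of `K = R/(X_1, …, X_n)`: the image of
`∂ : ⋀^k R^n → ⋀^(k-1) R^n` in the Koszul complex, which is the minimal graded free resolution
of `K`. -/
def syzygy (k : ℕ) : Submodule (MvPolynomial (Fin n) K) (KoszulAlgebra K n) :=
  (⋀[MvPolynomial (Fin n) K]^k (Fin n → MvPolynomial (Fin n) K)).map (koszulDifferential K n)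

/-- The multigrading of `M(n,k)`, inherited from the Koszul complex. -/
def syzygyComponent (k : ℕ) (a : Fin n → ℤ) : Submodule K (syzygy K n k) :=
  (koszulComponent K n a).comap ((syzygy K n k).subtype.restrictScalars K)

end Koszul

end StanleyKoszul

end

/-! Write `k = m + 1` and index the variables from `0`. An element of `M(n,k)` is a boundary, hence
determined by its coefficients at the terms `X^d e_U`, `|U| = m`, such that some `X_s` with `s < min
U` divides `X^d` (`eq_zero_of_mem_syzygy`). For `t < min U`, the term `X_t e_U` of `∂(e_t ∧ e_U)` is
of this kind, and every other term lies at some `e_V` with `min V = t < min U`. So choosing for each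
such `(U, d)` some `t < min U` in the support of `d` and multiplying `∂(e_t ∧ e_U)` by `X^d / X_t`
gives a family that is unitriangular with respect to `min U`, hence a `K`-basis.

It remains to group this basis into few-generator families. Put `w = min U` (`w = n` if `U = ∅`). A
partition of the nonempty subsets of `{0, …, w-1}` into intervals `[A, B]` groups the exponents `d`
by the interval containing `supp d ∩ [0, w)`. Each interval yields the summand with generator `X^{A
\ t} ∂(e_t ∧ e_U)`, `t = min A`, and variables indexed by `B` and by all `i ≥ w`. In the partition
used, `|A|` is odd, and `B` consists of the `x` whose parity is prescribed by a bit `p` and the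
number of elements of `A` below `x`.

Then `2|B| ≥ w` (`le_two_mul_count_compatible`). As `w ≤ n - m`, a summand has at least `n - w/2 ≥
(n + m)/2` variables, and rounding up gives `⌊(n + k)/2⌋`. -/

namespace StanleyKoszul

/-! ### Partition of the nonempty subsets of an initial segment into large intervals. -/

section IntervalPartition

variable {n : ℕ}

/-- The number of elements of `A` below `x`. -/
def countBelow (A : Finset (Fin n)) (x : ℕ) : ℕ := (A.filter fun a : Fin n => (a : ℕ) < x).card

/-- `x` is compatible with `(p, A)` if its parity is that of `p` plus the number of elements of `A`
below `x`. The elements compatible with `(p, A)` form the top of the interval with bottom `A`. -/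
def Compatible (p : ℕ) (A : Finset (Fin n)) (x : ℕ) : Prop := (x + countBelow A x + p) % 2 = 0

instance (p : ℕ) (A : Finset (Fin n)) : DecidablePred (Compatible p A) :=
  fun _ => inferInstanceAs (Decidable (_ = _))

theorem countBelow_zero (A : Finset (Fin n)) : countBelow A 0 = 0 := by simp [countBelow]

theorem countBelow_succ_of_mem {A : Finset (Fin n)} {x : Fin n} (hx : x ∈ A) :
    countBelow A (x + 1) = countBelow A x + 1 := by
  have : A.filter (fun a : Fin n => (a : ℕ) < x + 1) = insert x (A.filter fun a : Fin n => (a : ℕ) < x) := by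
    ext a
    simp only [Finset.mem_filter, Finset.mem_insert, Fin.ext_iff]
    constructor
    · rintro ⟨h1, h2⟩
      by_cases h : (a : ℕ) = x
      · exact Or.inl h
      · exact Or.inr ⟨h1, by omega⟩
    · rintro (h | ⟨h1, h2⟩)
      · exact ⟨by rwa [Fin.ext h], by omega⟩
      · exact ⟨h1, by omega⟩
  rw [countBelow, this, Finset.card_insert_of_notMem (by simp), countBelow]

theorem countBelow_succ_of_forall_ne {A : Finset (Fin n)} {x : ℕ} (hx : ∀ a ∈ A, (a : ℕ) ≠ x) :
    countBelow A (x + 1) = countBelow A x := by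
  unfold countBelow
  congr 1
  apply Finset.filter_congr
  intro a ha
  have := hx a ha
  omega

theorem countBelow_of_forall_lt {A : Finset (Fin n)} {x : ℕ} (hx : ∀ a ∈ A, (a : ℕ) < x) :
    countBelow A x = A.card := by
  rw [countBelow, Finset.filter_true_of_mem hx]

theorem countBelow_of_subset_insert {A S : Finset (Fin n)} {s : Fin n} (hA : A ⊆ insert s S)
    {x : ℕ} (hx : x ≤ s) : countBelow A x = countBelow (A ∩ S) x := by
  unfold countBelow
  congr 1
  ext a
  simp only [Finset.mem_filter, Finset.mem_inter]
  refine ⟨fun ⟨h1, h2⟩ => ⟨⟨h1, ?_⟩, h2⟩, fun ⟨h1, h2⟩ => ⟨h1.1, h2⟩⟩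
  rcases Finset.mem_insert.1 (hA h1) with rfl | h
  · omega
  · exact h

theorem card_of_subset_insert {A S : Finset (Fin n)} {s : Fin n} (hA : A ⊆ insert s S)
    (hs : s ∉ S) : A.card = (A ∩ S).card + if s ∈ A then 1 else 0 := by
  split_ifs with h
  · rw [← Finset.card_insert_of_notMem (a := s) (s := A ∩ S) (by simp [hs])]
    congr 1
    ext a
    have := @hA a
    simp only [Finset.mem_insert, Finset.mem_inter] at this ⊢
    grind
  · congr 1
    ext a
    have := @hA a
    simp only [Finset.mem_insert, Finset.mem_inter] at this ⊢
    grind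

/-- Uniqueness of the interval containing `S`. Compatibility of `s = max S` fixes the parity of the
number of elements of `A` below `s`, so induction determines that part of `A`; the parity of `|A|`
then decides whether `s ∈ A`. -/
theorem eq_of_compatible_of_parity {p : ℕ} (S : Finset (Fin n)) :
    ∀ A A' : Finset (Fin n), A ⊆ S → A' ⊆ S → (∀ x ∈ S, Compatible p A x) →
      (∀ x ∈ S, Compatible p A' x) → A.card % 2 = A'.card % 2 → A = A' := by
  induction S using Finset.induction_on_max with
  | empty =>
    intro A A' hA hA' _ _ _
    rw [Finset.subset_empty.1 hA, Finset.subset_empty.1 hA']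
  | insert s S hs ih =>
    intro A A' hA hA' h h' hc
    have hsS : s ∉ S := fun h => lt_irrefl _ (hs s h)
    have key : ∀ B : Finset (Fin n), B ⊆ insert s S → (∀ x ∈ insert s S, Compatible p B x) →
        (∀ x ∈ S, Compatible p (B ∩ S) x) ∧ ((s : ℕ) + (B ∩ S).card + p) % 2 = 0 := by
      intro B hB hBc
      constructor
      · intro x hx
        have := hBc x (Finset.mem_insert_of_mem hx)
        rwa [Compatible, countBelow_of_subset_insert hB (hs x hx).le] at this
      · have := hBc s (Finset.mem_insert_self _ _)
        rwa [Compatible, countBelow_of_subset_insert hB le_rfl, countBelow_of_forall_lt] at this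
        exact fun a ha => hs a (Finset.mem_inter.1 ha).2
    obtain ⟨k1, k2⟩ := key A hA h
    obtain ⟨k1', k2'⟩ := key A' hA' h'
    have heq := ih _ _ Finset.inter_subset_right Finset.inter_subset_right k1 k1' (by omega)
    have e1 := card_of_subset_insert hA hsS
    have e2 := card_of_subset_insert hA' hsS
    rw [heq] at e1
    have hiff : s ∈ A ↔ s ∈ A' := by
      by_cases a1 : s ∈ A <;> by_cases a2 : s ∈ A' <;> simp_all <;> omega
    ext a
    by_cases has : a = s
    · rw [has, hiff]
    · have h1 := @hA a
      have h2 := @hA' a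
      have h3 : a ∈ A ∩ S ↔ a ∈ A' ∩ S := by rw [heq]
      simp only [Finset.mem_insert, Finset.mem_inter] at h1 h2 h3
      grind

/-- No element of `A` lies below `min S`, so `p` is just the parity of `min S`. -/
theorem parity_eq_of_compatible {p p' : ℕ} {S A A' : Finset (Fin n)} (hS : S.Nonempty)
    (hA : A ⊆ S) (hA' : A' ⊆ S) (h : ∀ x ∈ S, Compatible p A x)
    (h' : ∀ x ∈ S, Compatible p' A' x) : p % 2 = p' % 2 := by
  have key : ∀ B ⊆ S, countBelow B (S.min' hS) = 0 := by
    intro B hB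
    rw [countBelow, Finset.card_eq_zero, Finset.filter_eq_empty_iff]
    intro a ha
    have := S.min'_le _ (hB ha)
    rw [Fin.le_def] at this
    omega
  have h1 := h _ (S.min'_mem hS)
  have h2 := h' _ (S.min'_mem hS)
  rw [Compatible, key _ hA] at h1
  rw [Compatible, key _ hA'] at h2
  omega

/-- Existence of the interval containing `S`. Quantifying over the parity `q` inside the choice of
`p` makes the induction work: below `s = max S` one takes the `B` whose parity makes `s` compatible.
Adding `s` to `B` or not then achieves either parity and affects no compatibility condition on `S`.
-/
theorem exists_compatible (S : Finset (Fin n)) (hS : S.Nonempty) :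
    ∃ p : Fin 2, ∀ q : ℕ, ∃ A ⊆ S, (∀ x ∈ S, Compatible p A x) ∧ A.card % 2 = q % 2 := by
  induction S using Finset.induction_on_max with
  | empty => simp at hS
  | insert s S hs ih =>
    have hsS : s ∉ S := fun h => lt_irrefl _ (hs s h)
    have key : ∀ (p : ℕ) (B A : Finset (Fin n)), B ⊆ S → (∀ x ∈ S, Compatible p B x) →
        ((s : ℕ) + B.card + p) % 2 = 0 → A ⊆ insert s S → A ∩ S = B →
        ∀ x ∈ insert s S, Compatible p A x := by
      rintro p B A hB hBc hBs hA rfl x hx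
      rcases Finset.mem_insert.1 hx with rfl | hx
      · rw [Compatible, countBelow_of_subset_insert hA le_rfl, countBelow_of_forall_lt]
        · exact hBs
        · exact fun a ha => hs a (Finset.mem_inter.1 ha).2
      · rw [Compatible, countBelow_of_subset_insert hA (hs x hx).le]
        exact hBc x hx
    have main : ∃ (p : Fin 2) (B : Finset (Fin n)), B ⊆ S ∧ (∀ x ∈ S, Compatible p B x) ∧
        ((s : ℕ) + B.card + p) % 2 = 0 := by
      rcases S.eq_empty_or_nonempty with rfl | hne
      · exact ⟨⟨(s : ℕ) % 2, by omega⟩, ∅, le_rfl, by simp, by simp; omega⟩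
      · obtain ⟨p, hp⟩ := ih hne
        obtain ⟨B, hB, hBc, hq⟩ := hp ((s : ℕ) + p)
        exact ⟨p, B, hB, hBc, by omega⟩
    obtain ⟨p, B, hB, hBc, hBs⟩ := main
    refine ⟨p, fun q => ?_⟩
    by_cases hq : B.card % 2 = q % 2
    · exact ⟨B, hB.trans (Finset.subset_insert _ _),
        key p B B hB hBc hBs (hB.trans (Finset.subset_insert _ _))
          (Finset.inter_eq_left.2 hB), hq⟩
    · refine ⟨insert s B, Finset.insert_subset_insert _ hB,
        key p B _ hB hBc hBs (Finset.insert_subset_insert _ hB) ?_, ?_⟩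
      · rw [Finset.insert_inter_of_notMem hsS, Finset.inter_eq_left.2 hB]
      · rw [Finset.card_insert_of_notMem fun h => hsS (hB h)]
        omega

/-- Outside `A`, compatibility flips from `x` to `x + 1`; at an element of `A`, both `x` and `x + 1`
are compatible. Thus no two consecutive numbers are incompatible. The possible deficit of one from
an incompatible start is made up at the first element of `A`, which is what the last summand
records. -/
theorem le_two_mul_count_compatible (p : ℕ) (A : Finset (Fin n))
    (hA : ∀ a ∈ A, Compatible p A a) (N : ℕ) :
    (N + if Compatible p A N then 0 else 1) ≤
      2 * Nat.count (Compatible p A) N + if countBelow A N = 0 then 1 else 0 := by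
  induction N with
  | zero => simp [countBelow_zero]; split_ifs <;> simp
  | succ N ih =>
    rw [Nat.count_succ]
    by_cases hN : ∃ a ∈ A, (a : ℕ) = N
    · obtain ⟨a, ha, rfl⟩ := hN
      have h1 := hA a ha
      have h2 : Compatible p A (a + 1) := by
        rw [Compatible, countBelow_succ_of_mem ha]
        rw [Compatible] at h1
        omega
      rw [countBelow_succ_of_mem ha]
      simp only [h1, h2, if_true] at ih ⊢
      split_ifs at ih ⊢ <;> omega
    · push Not at hN
      have h2 : Compatible p A (N + 1) ↔ ¬ Compatible p A N := by
        rw [Compatible, Compatible, countBelow_succ_of_forall_ne hN]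
        omega
      rw [countBelow_succ_of_forall_ne hN]
      simp only [h2]
      split_ifs at ih ⊢ <;> omega

theorem card_filter_fin_eq_count (n : ℕ) (P : ℕ → Prop) [DecidablePred P] :
    (Finset.univ.filter fun x : Fin n => P x).card = Nat.count P n := by
  induction n with
  | zero => simp
  | succ n ih =>
    rw [Nat.count_succ, ← ih, Finset.card_filter, Finset.card_filter, Fin.sum_univ_castSucc]
    simp

/-- At least half of the numbers below `w` and all numbers from `w` on are in the top of the
interval with bottom `A`, extended by all `x ≥ w`. -/
theorem two_mul_card_filter_le_or_compatible (p w : ℕ) (A : Finset (Fin n)) (hw : w ≤ n)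
    (hA : ∀ a ∈ A, Compatible p A a) (hAw : ∀ a ∈ A, (a : ℕ) < w) (hne : A.Nonempty) :
    2 * n ≤ 2 * (Finset.univ.filter fun x : Fin n => w ≤ x ∨ Compatible p A x).card + w := by
  rw [card_filter_fin_eq_count n fun x => w ≤ x ∨ Compatible p A x]
  have h1 : Nat.count (fun x => w ≤ x ∨ Compatible p A x) w = Nat.count (Compatible p A) w := by
    rw [Nat.count_eq_card_filter_range, Nat.count_eq_card_filter_range]
    congr 1
    apply Finset.filter_congr
    intro x hx
    have := Finset.mem_range.1 hx
    simp [this]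
  have h2 : ∀ m, Nat.count (fun x => w ≤ x ∨ Compatible p A x) (w + m) =
      Nat.count (Compatible p A) w + m := by
    intro m
    induction m with
    | zero => simpa using h1
    | succ m ih =>
      rw [← add_assoc, Nat.count_succ, ih, if_pos (Or.inl (by omega))]
      ring
  have h3 := le_two_mul_count_compatible p A hA w
  rw [countBelow_of_forall_lt hAw, if_neg (Finset.card_ne_zero.2 hne)] at h3
  have h4 := h2 (n - w)
  rw [Nat.add_sub_cancel' hw] at h4
  rw [h4]
  split_ifs at h3 <;> omega

end IntervalPartition

end StanleyKoszul

namespace StanleyKoszul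

/-! ### Linear algebra of unitriangular families. -/

section Unitriangular

variable {K M ι : Type*} [Field K] [AddCommGroup M] [Module K M]

/-- In a vanishing combination, the coordinate at an index of maximal rank among those with nonzero
coefficient equals that coefficient. -/
theorem linearIndependent_of_unitriangular (π : M →ₗ[K] (ι → K)) (z : ι → M) (ρ : ι → ℕ)
    (hdiag : ∀ j, π (z j) j = 1) (htri : ∀ i j, π (z i) j ≠ 0 → j = i ∨ ρ j < ρ i) :
    LinearIndependent K z := by
  classical
  rw [linearIndependent_iff']
  intro s c hsum
  by_contra! hne
  obtain ⟨i₀, hi₀, hci₀⟩ := hne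
  obtain ⟨j, hj, hmax⟩ := (s.filter fun i => c i ≠ 0).exists_max_image ρ
    ⟨i₀, Finset.mem_filter.2 ⟨hi₀, hci₀⟩⟩
  rw [Finset.mem_filter] at hj
  have h := congr_fun (congr_arg π hsum) j
  rw [map_sum, Finset.sum_apply, Finset.sum_eq_single j] at h
  · simp [hdiag, hj.2] at h
  · intro i hi hij
    by_cases hc : c i = 0
    · simp [hc]
    · have h1 := hmax i (Finset.mem_filter.2 ⟨hi, hc⟩)
      have h2 : π (z i) j = 0 := by
        by_contra h3
        rcases htri i j h3 with h4 | h4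
        · exact hij h4.symm
        · omega
      simp [h2]
  · exact fun h' => absurd hj.1 h'

theorem span_eq_top_of_unitriangular (π : M →ₗ[K] (ι → K)) (z : ι → M) (ρ : ι → ℕ) (N : ℕ)
    (hdiag : ∀ j, π (z j) j = 1) (htri : ∀ i j, π (z i) j ≠ 0 → j = i ∨ ρ j < ρ i)
    (hρ : ∀ j, ρ j < N) (hinj : ∀ y, π y = 0 → y = 0)
    (hfin : ∀ y, (Function.support (π y)).Finite) :
    Submodule.span K (Set.range z) = ⊤ := by
  classical
  have key : ∀ (w : ℕ) (y : M), (∀ j, π y j ≠ 0 → ρ j < w) →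
      y ∈ Submodule.span K (Set.range z) := by
    intro w
    induction w with
    | zero =>
      intro y hy
      rw [hinj y]
      · exact zero_mem _
      · ext j
        by_contra h
        exact absurd (hy j h) (by omega)
    | succ w ih =>
      intro y hy
      -- Clear the layer of rank `w`: distinct members of one layer do not interact, and subtracting
      -- them changes other coordinates only in lower rank.
      set s := (hfin y).toFinset.filter fun j => ρ j = w with hs
      set u := ∑ j ∈ s, π y j • z j with hu
      have hmem : u ∈ Submodule.span K (Set.range z) :=
        Submodule.sum_mem _ fun j _ => Submodule.smul_mem _ _ (Submodule.subset_span ⟨j, rfl⟩)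
      have hsub : y - u ∈ Submodule.span K (Set.range z) := by
        apply ih
        intro j hj
        by_contra hw
        apply hj
        have hval : ∀ i ∈ s, i ≠ j → π (z i) j = 0 := by
          intro i hi hij
          by_contra h
          rcases htri i j h with h' | h'
          · exact hij h'.symm
          · have := (Finset.mem_filter.1 hi).2
            omega
        have hπu : π u j = if j ∈ s then π y j else 0 := by
          rw [hu, map_sum, Finset.sum_apply]
          split_ifs with hjs
          · rw [Finset.sum_eq_single_of_mem j hjs]
            · simp [hdiag]
            · intro i hi hij
              simp [hval i hi hij]
          · apply Finset.sum_eq_zero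
            intro i hi
            have : i ≠ j := fun h => hjs (h ▸ hi)
            simp [hval i hi this]
        rw [map_sub, Pi.sub_apply, hπu]
        split_ifs with hjs
        · simp
        · by_contra h
          rw [sub_zero] at h
          have h1 := hy j h
          apply hjs
          rw [hs, Finset.mem_filter]
          exact ⟨(hfin y).mem_toFinset.2 h, by omega⟩
      have := add_mem hsub hmem
      rwa [sub_add_cancel] at this
  rw [eq_top_iff]
  intro y _
  exact key N y fun j _ => hρ j

end Unitriangular

/-! ### From monomial bases to Stanley decompositions. -/

section StanleyBasis

variable {K : Type*} [Field K] {n : ℕ} {M : Type*} [AddCommGroup M] [Module K M]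
  [Module (MvPolynomial (Fin n) K) M] [IsScalarTower K (MvPolynomial (Fin n) K) M]

theorem summand_eq_span (s : Finset (Fin n)) (x : M) :
    summand K s x = Submodule.span K (Set.range fun c : {c : Fin n →₀ ℕ // c.support ⊆ s} =>
      MvPolynomial.monomial c.1 (1 : K) • x) := by
  apply le_antisymm
  · rintro _ ⟨f, hf, rfl⟩
    have hf' : f ∈ MvPolynomial.supported K (s : Set (Fin n)) := hf
    rw [MvPolynomial.mem_supported] at hf'
    change f • x ∈ _
    rw [f.as_sum, Finset.sum_smul]
    refine Submodule.sum_mem _ fun c hc => ?_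
    have h1 : MvPolynomial.monomial c (MvPolynomial.coeff c f) • x =
        MvPolynomial.coeff c f • MvPolynomial.monomial c (1 : K) • x := by
      rw [← smul_assoc, MvPolynomial.smul_monomial, smul_eq_mul, mul_one]
    rw [h1]
    refine Submodule.smul_mem _ _ (Submodule.subset_span ⟨⟨c, fun i hi => ?_⟩, rfl⟩)
    exact hf' ((MvPolynomial.mem_vars_iff_mem_support i).2 ⟨c, hc, hi⟩)
  · rw [Submodule.span_le]
    rintro _ ⟨c, rfl⟩
    refine ⟨MvPolynomial.monomial c.1 1, ?_, rfl⟩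
    change _ ∈ MvPolynomial.supported K (s : Set (Fin n))
    rw [MvPolynomial.mem_supported, MvPolynomial.vars_monomial one_ne_zero]
    exact_mod_cast c.2

/-- A `K`-basis of `M` that consists of the multiples of finitely many homogeneous elements
`x_i` by the monomials in the indeterminates `X_j`, `j ∈ vars i`, gives a Stanley decomposition. -/
theorem le_stanleyDepth_of_basis (𝓜 : (Fin n → ℤ) → Submodule K M) {I : Type*} [Finite I]
    (vars : I → Finset (Fin n)) (gen : I → M) (hhom : ∀ i, ∃ a, gen i ∈ 𝓜 a)
    (hli : LinearIndependent K fun q : Σ i, {c : Fin n →₀ ℕ // c.support ⊆ vars i} =>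
      MvPolynomial.monomial q.2.1 (1 : K) • gen q.1)
    (hspan : Submodule.span K (Set.range fun q : Σ i, {c : Fin n →₀ ℕ // c.support ⊆ vars i} =>
      MvPolynomial.monomial q.2.1 (1 : K) • gen q.1) = ⊤)
    (d : ℕ) (hd : ∀ i, d ≤ (vars i).card) : (d : ℕ∞) ≤ stanleyDepth 𝓜 := by
  have hsummand : ∀ i, summand K (vars i) (gen i) = Submodule.span K
      ((fun q : Σ i, {c : Fin n →₀ ℕ // c.support ⊆ vars i} =>
        MvPolynomial.monomial q.2.1 (1 : K) • gen q.1) '' {q | q.1 = i}) := by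
    intro i
    rw [summand_eq_span]
    congr 1
    ext y
    constructor
    · rintro ⟨c, rfl⟩
      exact ⟨⟨i, c⟩, rfl, rfl⟩
    · rintro ⟨⟨j, c⟩, rfl, rfl⟩
      exact ⟨c, rfl⟩
  have hindep : iSupIndep fun i => summand K (vars i) (gen i) := by
    intro i
    simp only [hsummand]
    simp only [← Submodule.span_iUnion]
    rw [← Set.image_iUnion₂]
    apply hli.disjoint_span_image
    rw [Set.disjoint_left]
    intro q hq hq'
    simp only [Set.mem_iUnion, Set.mem_ofPred_eq] at hq hq'
    obtain ⟨j, hj, hqj⟩ := hq'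
    exact hj (hqj.symm.trans hq)
  have htop : ⨆ i, summand K (vars i) (gen i) = ⊤ := by
    rw [eq_top_iff, ← hspan, Submodule.span_le]
    rintro _ ⟨q, rfl⟩
    refine Submodule.mem_iSup_of_mem q.1 ?_
    rw [hsummand]
    exact Submodule.subset_span ⟨q, rfl, rfl⟩
  obtain ⟨N, ⟨e⟩⟩ := Finite.exists_equiv_fin I
  let D : StanleyDecomposition 𝓜 :=
    { size := N
      vars := fun i => vars (e.symm i)
      gen := fun i => gen (e.symm i)
      homogeneous := fun i => hhom _
      ann_eq_zero := by
        intro i f hf hfx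
        rw [MvPolynomial.mem_supported] at hf
        have hli' : LinearIndependent K
            fun c : {c : Fin n →₀ ℕ // c.support ⊆ vars (e.symm i)} =>
              MvPolynomial.monomial c.1 (1 : K) • gen (e.symm i) :=
          hli.comp (fun c => (⟨e.symm i, c⟩ : Σ i, {c : Fin n →₀ ℕ // c.support ⊆ vars i}))
            (fun c c' h => by simpa using h)
        have hsupp : ∀ c ∈ f.support, c.support ⊆ vars (e.symm i) := fun c hc j hj =>
          hf ((MvPolynomial.mem_vars_iff_mem_support j).2 ⟨c, hc, hj⟩)
        rw [linearIndependent_iff'] at hli'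
        have h0 := hli' (f.support.subtype fun c => c.support ⊆ vars (e.symm i))
          (fun c => MvPolynomial.coeff c.1 f) ?_
        · ext c
          rw [MvPolynomial.coeff_zero]
          by_contra hc
          have hc' : c ∈ f.support := MvPolynomial.mem_support_iff.2 hc
          exact hc (h0 ⟨c, hsupp c hc'⟩ (Finset.mem_subtype.2 hc'))
        · rw [Finset.sum_subtype_of_mem
            (fun c => MvPolynomial.coeff c f • MvPolynomial.monomial c (1 : K) • gen (e.symm i))
            hsupp, ← hfx]
          conv_rhs => rw [f.as_sum, Finset.sum_smul]
          refine Finset.sum_congr rfl fun c _ => ?_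
          rw [← smul_assoc, MvPolynomial.smul_monomial, smul_eq_mul, mul_one]
      isInternal := by
        apply DirectSum.isInternal_submodule_of_iSupIndep_of_iSup_eq_top
        · exact hindep.comp e.symm.injective
        · rw [← htop]
          exact e.symm.iSup_comp (g := fun i => summand K (vars i) (gen i)) }
  refine le_trans ?_ (le_iSup (fun D : StanleyDecomposition 𝓜 => D.depth) D)
  exact le_iInf fun i => by exact_mod_cast hd (e.symm i)

end StanleyBasis

end StanleyKoszul

noncomputable section

namespace StanleyKoszul

/-! ### Coordinates in the Koszul complex and the coefficients that determine a syzygy. -/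

section KoszulCoordinates

variable (K : Type*) [Field K] (n : ℕ)

/-- Contraction by the `v`-th coordinate form on `R^n`. -/
def contractCoord (v : Fin n) :
    KoszulAlgebra K n →ₗ[MvPolynomial (Fin n) K] KoszulAlgebra K n :=
  CliffordAlgebra.contractLeft
    (LinearMap.proj v : (Fin n → MvPolynomial (Fin n) K) →ₗ[MvPolynomial (Fin n) K] _)

/-- The coordinate of an element of the Koszul algebra at `e_{v_1} ∧ … ∧ e_{v_m}`, computed by
successive contractions. -/
def koszulCoord : List (Fin n) →
    KoszulAlgebra K n →ₗ[MvPolynomial (Fin n) K] MvPolynomial (Fin n) K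
  | [] => ExteriorAlgebra.algebraMapInv.toLinearMap
  | v :: L => koszulCoord L ∘ₗ contractCoord K n v

/-- The product `e_{v_1} ∧ … ∧ e_{v_m}`. -/
def koszulProd (L : List (Fin n)) : KoszulAlgebra K n := (L.map (koszulGen K n)).prod

variable {K n}

theorem koszulProd_cons (v : Fin n) (L : List (Fin n)) :
    koszulProd K n (v :: L) = koszulGen K n v * koszulProd K n L := by
  simp [koszulProd]

theorem koszulCoord_cons (v : Fin n) (L : List (Fin n)) (y : KoszulAlgebra K n) :
    koszulCoord K n (v :: L) y = koszulCoord K n L (contractCoord K n v y) := rfl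

theorem contractCoord_gen_mul (v w : Fin n) (y : KoszulAlgebra K n) :
    contractCoord K n v (koszulGen K n w * y) =
      (if v = w then y else 0) - koszulGen K n w * contractCoord K n v y := by
  rw [contractCoord, koszulGen]
  refine (CliffordAlgebra.contractLeft_ι_mul _ _ _).trans ?_
  congr 1
  simp only [LinearMap.proj_apply, Pi.single_apply]
  split_ifs <;> simp

theorem contractCoord_comm (v w : Fin n) (y : KoszulAlgebra K n) :
    contractCoord K n v (contractCoord K n w y) =
      -contractCoord K n w (contractCoord K n v y) :=
  CliffordAlgebra.contractLeft_comm _ _ _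

theorem contractCoord_contractCoord (v : Fin n) (y : KoszulAlgebra K n) :
    contractCoord K n v (contractCoord K n v y) = 0 :=
  CliffordAlgebra.contractLeft_contractLeft _ _

/-- The sign need not be tracked, since this serves only to show that coordinates vanish. -/
theorem koszulCoord_perm {L L' : List (Fin n)} (h : L.Perm L') :
    ∀ y, koszulCoord K n L y = koszulCoord K n L' y ∨
      koszulCoord K n L y = -koszulCoord K n L' y := by
  induction h with
  | nil => exact fun _ => Or.inl rfl
  | cons v _ ih => exact fun y => ih _
  | swap v w L =>
    intro y
    right
    simp only [koszulCoord_cons]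
    rw [contractCoord_comm, map_neg]
  | trans _ _ ih1 ih2 =>
    intro y
    rcases ih1 y with h1 | h1 <;> rcases ih2 y with h2 | h2 <;> simp [h1, h2]

theorem koszulCoord_cons_of_mem {v : Fin n} {L : List (Fin n)} (h : v ∈ L)
    (y : KoszulAlgebra K n) : koszulCoord K n (v :: L) y = 0 := by
  have hp : (v :: L).Perm (v :: v :: L.erase v) := (List.perm_cons_erase h).cons v
  have h0 : koszulCoord K n (v :: v :: L.erase v) y = 0 := by
    simp only [koszulCoord_cons]
    rw [contractCoord_contractCoord, map_zero]
  rcases koszulCoord_perm hp y with h1 | h1 <;> simp [h1, h0]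

theorem koszulCoord_gen_mul_of_notMem {v : Fin n} {L : List (Fin n)} (h : v ∉ L) :
    ∀ y : KoszulAlgebra K n, koszulCoord K n L (koszulGen K n v * y) = 0 := by
  induction L with
  | nil =>
    intro y
    change ExteriorAlgebra.algebraMapInv (koszulGen K n v * y) = 0
    rw [map_mul, koszulGen, ExteriorAlgebra.algebraMapInv, ExteriorAlgebra.lift_ι_apply]
    simp
  | cons w L ih =>
    intro y
    rw [List.mem_cons, not_or] at h
    rw [koszulCoord_cons, contractCoord_gen_mul, if_neg (Ne.symm h.1), zero_sub, map_neg, ih h.2,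
      neg_zero]

theorem koszulCoord_self {L : List (Fin n)} (h : L.Nodup) :
    koszulCoord K n L (koszulProd K n L) = 1 := by
  induction L with
  | nil => simp [koszulCoord, koszulProd]
  | cons v L ih =>
    rw [List.nodup_cons] at h
    rw [koszulProd_cons, koszulCoord_cons, contractCoord_gen_mul, if_pos rfl, map_sub, ih h.2,
      koszulCoord_gen_mul_of_notMem h.1, sub_zero]

theorem contractCoord_koszulProd_of_notMem {v : Fin n} {L : List (Fin n)} (h : v ∉ L) :
    contractCoord K n v (koszulProd K n L) = 0 := by
  induction L with
  | nil => exact CliffordAlgebra.contractLeft_one _ _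
  | cons w L ih =>
    rw [List.mem_cons, not_or] at h
    rw [koszulProd_cons, contractCoord_gen_mul, if_neg h.1, ih h.2, mul_zero, sub_zero]

theorem koszulCoord_koszulProd_of_notMem {v : Fin n} {L L' : List (Fin n)} (hv : v ∈ L)
    (hv' : v ∉ L') : koszulCoord K n L (koszulProd K n L') = 0 := by
  have h0 : koszulCoord K n (v :: L.erase v) (koszulProd K n L') = 0 := by
    rw [koszulCoord_cons, contractCoord_koszulProd_of_notMem hv', map_zero]
  rcases koszulCoord_perm (List.perm_cons_erase hv) (koszulProd K n L') with h1 | h1 <;>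
    simp [h1, h0]

theorem koszulCoord_sort_koszulProd_sort {U V : Finset (Fin n)} (h : U.card = V.card) :
    koszulCoord K n U.sort (koszulProd K n V.sort) = if U = V then 1 else 0 := by
  split_ifs with hUV
  · rw [hUV, koszulCoord_self (Finset.sort_nodup _ _)]
  · obtain ⟨v, hv, hv'⟩ : ∃ v ∈ U, v ∉ V := by
      by_contra! hsub
      exact hUV (Finset.eq_of_subset_of_card_le hsub h.ge)
    exact koszulCoord_koszulProd_of_notMem (v := v) (by simpa using hv) (by simpa using hv')

theorem koszulDifferential_eq_sum (y : KoszulAlgebra K n) :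
    koszulDifferential K n y =
      ∑ v, (MvPolynomial.X v : MvPolynomial (Fin n) K) • contractCoord K n v y := by
  have h : Fintype.linearCombination (MvPolynomial (Fin n) K)
      (MvPolynomial.X : Fin n → MvPolynomial (Fin n) K) =
      ∑ v, (MvPolynomial.X v : MvPolynomial (Fin n) K) •
        (LinearMap.proj v : (Fin n → MvPolynomial (Fin n) K) →ₗ[MvPolynomial (Fin n) K] _) := by
    apply LinearMap.ext
    intro f
    simp [Fintype.linearCombination_apply, LinearMap.sum_apply, mul_comm]
  rw [koszulDifferential, h, map_sum, LinearMap.sum_apply]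
  refine Finset.sum_congr rfl fun v _ => ?_
  rw [map_smul]
  rfl

/-- No signs occur because the new index is placed in front, where it is contracted first. -/
theorem koszulCoord_koszulDifferential (L : List (Fin n)) (y : KoszulAlgebra K n) :
    koszulCoord K n L (koszulDifferential K n y) =
      ∑ v, MvPolynomial.X v * koszulCoord K n (v :: L) y := by
  rw [koszulDifferential_eq_sum, map_sum]
  refine Finset.sum_congr rfl fun v _ => ?_
  rw [map_smul, smul_eq_mul, koszulCoord_cons]

theorem koszulDifferential_koszulDifferential (y : KoszulAlgebra K n) :
    koszulDifferential K n (koszulDifferential K n y) = 0 :=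
  CliffordAlgebra.contractLeft_contractLeft _ _

theorem koszulDifferential_gen_mul (v : Fin n) (y : KoszulAlgebra K n) :
    koszulDifferential K n (koszulGen K n v * y) =
      (MvPolynomial.X v : MvPolynomial (Fin n) K) • y -
        koszulGen K n v * koszulDifferential K n y := by
  rw [koszulDifferential, koszulGen]
  refine (CliffordAlgebra.contractLeft_ι_mul _ _ _).trans ?_
  congr 2
  simp [Fintype.linearCombination_apply, Pi.single_apply]

theorem koszulProd_mem_exteriorPower (L : List (Fin n)) :
    koszulProd K n L ∈
      ⋀[MvPolynomial (Fin n) K]^L.length (Fin n → MvPolynomial (Fin n) K) := by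
  induction L with
  | nil => simp [koszulProd, Submodule.one_le.1]
  | cons v L ih =>
    rw [koszulProd_cons, List.length_cons, ExteriorAlgebra.exteriorPower, pow_succ']
    exact Submodule.mul_mem_mul ⟨_, rfl⟩ ih

theorem koszulDifferential_mem_exteriorPower (m : ℕ) : ∀ y : KoszulAlgebra K n,
    y ∈ ⋀[MvPolynomial (Fin n) K]^(m + 1) (Fin n → MvPolynomial (Fin n) K) →
    koszulDifferential K n y ∈
      ⋀[MvPolynomial (Fin n) K]^m (Fin n → MvPolynomial (Fin n) K) := by
  induction m with
  | zero =>
    intro y hy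
    rw [zero_add, ExteriorAlgebra.exteriorPower, pow_one] at hy
    obtain ⟨v, rfl⟩ := hy
    rw [ExteriorAlgebra.exteriorPower, pow_zero]
    refine Submodule.mem_one.2 ⟨_, (CliffordAlgebra.contractLeft_ι _ _ v).symm⟩
  | succ m ih =>
    intro y hy
    rw [ExteriorAlgebra.exteriorPower, pow_succ'] at hy
    induction hy using Submodule.mul_induction_on' with
    | mem_mul_mem a ha b hb =>
      obtain ⟨v, rfl⟩ := ha
      rw [koszulDifferential]
      have h := CliffordAlgebra.contractLeft_ι_mul (Q := (0 : QuadraticForm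
        (MvPolynomial (Fin n) K) (Fin n → MvPolynomial (Fin n) K)))
        (d := Fintype.linearCombination (MvPolynomial (Fin n) K)
          (MvPolynomial.X : Fin n → MvPolynomial (Fin n) K)) v b
      refine (congrArg (· ∈ _) h).mpr ?_
      refine Submodule.sub_mem _ (Submodule.smul_mem _ _ hb) ?_
      rw [ExteriorAlgebra.exteriorPower, pow_succ']
      exact Submodule.mul_mem_mul ⟨v, rfl⟩ (ih b hb)
    | add a _ b _ iha ihb =>
      rw [map_add]
      exact Submodule.add_mem _ iha ihb

theorem coe_ιMulti_family_basisFun (m : ℕ) (s : Set.powersetCard (Fin n) m) :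
    (exteriorPower.ιMulti_family (MvPolynomial (Fin n) K) m
      (Pi.basisFun (MvPolynomial (Fin n) K) (Fin n)) s : KoszulAlgebra K n) =
      koszulProd K n (s : Finset (Fin n)).sort := by
  obtain ⟨s, hs⟩ := s
  rw [exteriorPower.ιMulti_family_apply_coe, ExteriorAlgebra.ιMulti_family,
    ExteriorAlgebra.ιMulti_apply, koszulProd]
  congr 1
  apply List.ext_getElem
  · simpa using hs.symm
  · intro i h1 h2
    simp only [List.getElem_ofFn, List.getElem_map, koszulGen, Function.comp_apply,
      Pi.basisFun_apply, Set.powersetCard.ofFinEmbEquiv_symm_apply]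
    exact congrArg (fun x => ExteriorAlgebra.ι _ (Pi.single x 1))
      (s.orderEmbOfFin_apply hs ⟨i, by simpa using h1⟩)

theorem eq_zero_of_koszulCoord_eq_zero {m : ℕ} {y : KoszulAlgebra K n}
    (hy : y ∈ ⋀[MvPolynomial (Fin n) K]^m (Fin n → MvPolynomial (Fin n) K))
    (h : ∀ U : Finset (Fin n), U.card = m → koszulCoord K n U.sort y = 0) : y = 0 := by
  let b := (Pi.basisFun (MvPolynomial (Fin n) K) (Fin n)).exteriorPower m
  have hsum : y = ∑ s : Set.powersetCard (Fin n) m, b.repr ⟨y, hy⟩ s •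
      koszulProd K n (s : Finset (Fin n)).sort := by
    have := congrArg Subtype.val (b.sum_repr ⟨y, hy⟩)
    refine this.symm.trans ?_
    rw [Submodule.coe_sum]
    refine Finset.sum_congr rfl fun s _ => ?_
    rw [Submodule.coe_smul, ← coe_ιMulti_family_basisFun, ← exteriorPower.basis_apply]
  have hcoord : ∀ s, b.repr ⟨y, hy⟩ s = 0 := by
    intro s
    have h0 := h s s.2
    rw [hsum, map_sum, Finset.sum_eq_single s] at h0
    · rwa [map_smul, koszulCoord_sort_koszulProd_sort rfl, if_pos rfl, smul_eq_mul, mul_one] at h0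
    · intro t _ hts
      rw [map_smul, koszulCoord_sort_koszulProd_sort (s.2.trans t.2.symm),
        if_neg fun h => hts (Subtype.ext h.symm), smul_zero]
    · simp
  rw [hsum]
  exact Finset.sum_eq_zero fun s _ => by rw [hcoord, zero_smul]

theorem mem_exteriorPower_of_mem_syzygy {m : ℕ} {y : KoszulAlgebra K n}
    (hy : y ∈ syzygy K n (m + 1)) :
    y ∈ ⋀[MvPolynomial (Fin n) K]^m (Fin n → MvPolynomial (Fin n) K) := by
  obtain ⟨z, hz, rfl⟩ := hy
  exact koszulDifferential_mem_exteriorPower m z hz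

/-- An element of a syzygy module is determined by its coefficients at those `X^d e_U` for which
some indeterminate smaller than all elements of `U` divides `X^d`. -/
theorem eq_zero_of_mem_syzygy {m : ℕ} {y : KoszulAlgebra K n} (hy : y ∈ syzygy K n (m + 1))
    (h : ∀ (U : Finset (Fin n)) (d : Fin n →₀ ℕ), U.card = m →
      (∃ s ∈ d.support, ∀ u ∈ U, s < u) →
      MvPolynomial.coeff d (koszulCoord K n U.sort y) = 0) : y = 0 := by
  refine eq_zero_of_koszulCoord_eq_zero (mem_exteriorPower_of_mem_syzygy hy) fun U hU => ?_
  ext d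
  rw [MvPolynomial.coeff_zero]
  by_cases hd : ∃ s ∈ d.support, ∀ u ∈ U, s < u
  · exact h U d hU hd
  push Not at hd
  obtain ⟨z, -, rfl⟩ := hy
  -- For `U = ∅` the only term not covered by `h` is the constant one, absent because `∂z` has
  -- coefficients in the ideal of the variables.
  rcases U.eq_empty_or_nonempty with rfl | hne
  · have hd0 : d = 0 := by
      ext s
      by_contra hs
      simpa using hd s (Finsupp.mem_support_iff.2 hs)
    rw [hd0, koszulCoord_koszulDifferential, MvPolynomial.coeff_sum]
    exact Finset.sum_eq_zero fun v _ => by rw [MvPolynomial.coeff_X_mul']; simp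
  · set y := koszulDifferential K n z with hydef
    set u := U.min' hne with hu
    have huU : u ∈ U := U.min'_mem hne
    have hlt : ∀ v ∈ U.erase u, u < v := fun v hv =>
      lt_of_le_of_ne (U.min'_le v (Finset.mem_of_mem_erase hv)) (Finset.ne_of_mem_erase hv).symm
    have hsort : U.sort = u :: (U.erase u).sort := by
      conv_lhs => rw [← Finset.insert_erase huU]
      exact Finset.sort_insert _ (fun v hv => (hlt v hv).le) (Finset.notMem_erase u U)
    -- With `u = min U`, compare coefficients of `∂y = 0` at `X^d X_u e_{U \ u}`. The contribution
    -- of `v = u` is the desired coefficient.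
    have h0 : koszulCoord K n (U.erase u).sort (koszulDifferential K n y) = 0 := by
      rw [hydef, koszulDifferential_koszulDifferential, map_zero]
    rw [koszulCoord_koszulDifferential] at h0
    have h1 := congrArg (MvPolynomial.coeff (d + Finsupp.single u 1)) h0
    rw [MvPolynomial.coeff_sum, MvPolynomial.coeff_zero, Finset.sum_eq_single u, add_comm,
      MvPolynomial.coeff_X_mul] at h1
    · rwa [hsort]
    · intro v _ hvu
      rw [MvPolynomial.coeff_X_mul']
      split_ifs with hv
      · have hvd : v ∈ d.support := by
          rw [Finsupp.mem_support_iff, Finsupp.add_apply, Finsupp.single_apply,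
            if_neg (Ne.symm hvu), add_zero] at hv
          exact Finsupp.mem_support_iff.2 hv
        -- For `v ≠ u` the contribution comes from `e_v ∧ e_{U \ u}` with a monomial still divisible
        -- by `X_u`. As `u` is smaller than `v` and than all of `U \ u`, this coefficient vanishes
        -- by `h`.
        have huv : u < v := by
          obtain ⟨w, hw, hwv⟩ := hd v hvd
          exact lt_of_le_of_ne ((U.min'_le w hw).trans hwv) (Ne.symm hvu)
        by_cases hvU : v ∈ U.erase u
        · rw [koszulCoord_cons_of_mem (by simpa using hvU), MvPolynomial.coeff_zero]
        · have hperm : (v :: (U.erase u).sort).Perm (insert v (U.erase u)).sort := by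
            rw [List.perm_ext_iff_of_nodup]
            · intro a; simp
            · simpa using hvU
            · exact Finset.sort_nodup _ _
          have h2 := h (insert v (U.erase u)) (d + Finsupp.single u 1 - Finsupp.single v 1)
            (by rw [Finset.card_insert_of_notMem hvU, Finset.card_erase_add_one huU, hU])
            ⟨u, by simp [hvu],
              fun w hw => (Finset.mem_insert.1 hw).elim (fun e => e ▸ huv) (hlt w)⟩
          rcases koszulCoord_perm hperm y with h3 | h3 <;> simp [h3, h2]
      · rfl
    · simp

theorem gen_mul_mem_koszulComponent (v : Fin n) {a : Fin n → ℤ} {y : KoszulAlgebra K n}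
    (hy : y ∈ koszulComponent K n a) :
    koszulGen K n v * y ∈ koszulComponent K n (a + Pi.single v 1) := by
  induction hy using Submodule.span_induction with
  | mem y hy =>
    obtain ⟨c, l, h, rfl⟩ := hy
    refine Submodule.subset_span ⟨c, v :: l, fun i => ?_, ?_⟩
    · rw [Pi.add_apply, ← h i, List.count_cons]
      by_cases hi : i = v
      · subst hi; simp; ring
      · simp [hi, Ne.symm hi]
    · rw [List.map_cons, List.prod_cons, mul_smul_comm]
  | zero => rw [mul_zero]; exact zero_mem _
  | add x y _ _ hx hy => rw [mul_add]; exact add_mem hx hy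
  | smul r x _ hx => rw [mul_smul_comm]; exact Submodule.smul_mem _ _ hx

theorem monomial_smul_mem_koszulComponent (b : Fin n →₀ ℕ) {a : Fin n → ℤ}
    {y : KoszulAlgebra K n} (hy : y ∈ koszulComponent K n a) :
    MvPolynomial.monomial b (1 : K) • y ∈ koszulComponent K n (a + fun i => (b i : ℤ)) := by
  induction hy using Submodule.span_induction with
  | mem y hy =>
    obtain ⟨c, l, h, rfl⟩ := hy
    refine Submodule.subset_span ⟨b + c, l, fun i => ?_, ?_⟩
    · rw [Pi.add_apply, ← h i, Finsupp.add_apply]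
      push_cast
      ring
    · rw [smul_smul, MvPolynomial.monomial_mul, one_mul]
  | zero => rw [smul_zero]; exact zero_mem _
  | add x y _ _ hx hy => rw [smul_add]; exact add_mem hx hy
  | smul r x _ hx => rw [smul_comm]; exact Submodule.smul_mem _ _ hx

theorem koszulDifferential_koszulProd_mem_koszulComponent (L : List (Fin n)) :
    koszulDifferential K n (koszulProd K n L) ∈
      koszulComponent K n fun i => ((L.count i : ℕ) : ℤ) := by
  induction L with
  | nil =>
    have : koszulDifferential K n (koszulProd K n []) = 0 := CliffordAlgebra.contractLeft_one _ _
    rw [this]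
    exact zero_mem _
  | cons v L ih =>
    rw [koszulProd_cons, koszulDifferential_gen_mul]
    have hcount : (fun i => (((v :: L).count i : ℕ) : ℤ)) =
        (fun i => ((L.count i : ℕ) : ℤ)) + Pi.single v 1 := by
      ext i
      rw [Pi.add_apply, List.count_cons]
      by_cases hi : i = v
      · subst hi; simp
      · simp [hi, Ne.symm hi]
    refine sub_mem (Submodule.subset_span ⟨Finsupp.single v 1, L, fun i => ?_, rfl⟩) ?_
    · simp only [List.count_cons]
      by_cases hi : i = v
      · subst hi; simp; ring
      · simp [hi, Ne.symm hi]
    · rw [hcount]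
      exact gen_mul_mem_koszulComponent v ih

end KoszulCoordinates

end StanleyKoszul

end

noncomputable section

namespace StanleyKoszul

/-! ### The summands, their leading terms and the resulting basis. -/

section Decomposition

variable {n : ℕ}

/-- The least element of `U`, and `n` if `U` is empty. -/
def minOr (U : Finset (Fin n)) : ℕ := if h : U.Nonempty then (U.min' h : ℕ) else n

theorem lt_minOr_iff (U : Finset (Fin n)) (a : Fin n) :
    (a : ℕ) < minOr U ↔ ∀ u ∈ U, a < u := by
  unfold minOr
  split_ifs with h
  · rw [← Fin.lt_def, Finset.lt_min'_iff]
  · rw [Finset.not_nonempty_iff_eq_empty] at h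
    simp [h]

theorem minOr_add_card_le (U : Finset (Fin n)) : minOr U + U.card ≤ n := by
  unfold minOr
  split_ifs with h
  · have h1 : U ⊆ Finset.Ici (U.min' h) := fun u hu => Finset.mem_Ici.2 (U.min'_le u hu)
    have h2 := Finset.card_le_card h1
    rw [Fin.card_Ici] at h2
    have := (U.min' h).2
    omega
  · rw [Finset.not_nonempty_iff_eq_empty] at h
    simp [h]

/-- The exponent vector of the squarefree monomial with support `A`. -/
def squarefreeExponent (A : Finset (Fin n)) : Fin n →₀ ℕ := ∑ a ∈ A, Finsupp.single a 1

theorem squarefreeExponent_apply (A : Finset (Fin n)) (i : Fin n) :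
    squarefreeExponent A i = if i ∈ A then 1 else 0 := by
  simp [squarefreeExponent, Finsupp.finsetSum_apply, Finsupp.single_apply]

theorem squarefreeExponent_erase_add {A : Finset (Fin n)} {t : Fin n} (ht : t ∈ A) :
    squarefreeExponent (A.erase t) + Finsupp.single t 1 = squarefreeExponent A :=
  Finset.sum_erase_add A _ ht

/-- The summands of the decomposition of the `(m + 1)`-st syzygy module: sets `U` of size `m`
together with an interval of sets of elements smaller than those of `U`. -/
def SummandIndex (n m : ℕ) : Type :=
  {q : Finset (Fin n) × Fin 2 × Finset (Fin n) // q.1.card = m ∧ q.2.2.card % 2 = 1 ∧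
    (∀ a ∈ q.2.2, (a : ℕ) < minOr q.1) ∧ ∀ a ∈ q.2.2, Compatible q.2.1 q.2.2 a}

namespace SummandIndex

variable {m : ℕ}

instance : Finite (SummandIndex n m) := inferInstanceAs (Finite {_q // _})

/-- The factor `e_U` of the leading term. -/
def ext (q : SummandIndex n m) : Finset (Fin n) := q.1.1

/-- The parity of the interval. -/
def parity (q : SummandIndex n m) : Fin 2 := q.1.2.1

/-- The support of the monomial factor of the leading term. -/
def bot (q : SummandIndex n m) : Finset (Fin n) := q.1.2.2

theorem card_ext (q : SummandIndex n m) : q.ext.card = m := q.2.1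

theorem bot_nonempty (q : SummandIndex n m) : q.bot.Nonempty := by
  rw [← Finset.card_pos]
  have : q.bot.card % 2 = 1 := q.2.2.1
  omega

theorem lt_of_mem_bot (q : SummandIndex n m) : ∀ a ∈ q.bot, (a : ℕ) < minOr q.ext := q.2.2.2.1

theorem compatible (q : SummandIndex n m) : ∀ a ∈ q.bot, Compatible q.parity q.bot a :=
  q.2.2.2.2

/-- The index `t` of the exterior factor that is contracted to give the leading term. -/
def pivot (q : SummandIndex n m) : Fin n := q.bot.min' q.bot_nonempty

theorem pivot_mem (q : SummandIndex n m) : q.pivot ∈ q.bot := Finset.min'_mem _ _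

theorem pivot_notMem (q : SummandIndex n m) : q.pivot ∉ q.ext := fun h =>
  lt_irrefl _ ((lt_minOr_iff _ _).1 (q.lt_of_mem_bot _ q.pivot_mem) _ h)

/-- The indeterminates acting freely on the summand. -/
def vars (q : SummandIndex n m) : Finset (Fin n) :=
  Finset.univ.filter fun x : Fin n => minOr q.ext ≤ x ∨ Compatible q.parity q.bot x

theorem le_card_vars (q : SummandIndex n m) : (n + (m + 1)) / 2 ≤ q.vars.card := by
  have h1 := minOr_add_card_le q.ext
  rw [q.card_ext] at h1
  have h2 : 2 * n ≤ 2 * q.vars.card + minOr q.ext :=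
    two_mul_card_filter_le_or_compatible q.parity (minOr q.ext) q.bot (by omega) q.compatible
      q.lt_of_mem_bot q.bot_nonempty
  omega

/-- The exponent vector of the leading term `X^d e_U` of a monomial multiple of the generator. -/
def leadExponent (p : Σ q : SummandIndex n m, {c : Fin n →₀ ℕ // c.support ⊆ q.vars}) :
    Fin n →₀ ℕ := p.2.1 + squarefreeExponent p.1.bot

/-- The part of `supp d` below `min U` lies in the interval of the summand, so it determines first
the bit, then the bottom; the cofactor follows by cancellation. -/
theorem eq_of_lead_eq {p p' : Σ q : SummandIndex n m, {c : Fin n →₀ ℕ // c.support ⊆ q.vars}}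
    (hU : p.1.ext = p'.1.ext) (hd : leadExponent p = leadExponent p') : p = p' := by
  have key : ∀ r : Σ q : SummandIndex n m, {c : Fin n →₀ ℕ // c.support ⊆ q.vars},
      r.1.bot ⊆ (leadExponent r).support.filter (fun x : Fin n => (x : ℕ) < minOr r.1.ext) ∧
      ∀ x ∈ (leadExponent r).support.filter (fun x : Fin n => (x : ℕ) < minOr r.1.ext),
        Compatible r.1.parity r.1.bot x := by
    intro r
    constructor
    · intro a ha
      rw [Finset.mem_filter, Finsupp.mem_support_iff, leadExponent, Finsupp.add_apply,
        squarefreeExponent_apply, if_pos ha]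
      exact ⟨by omega, r.1.lt_of_mem_bot a ha⟩
    · intro x hx
      rw [Finset.mem_filter, Finsupp.mem_support_iff, leadExponent, Finsupp.add_apply,
        squarefreeExponent_apply] at hx
      by_cases hxb : x ∈ r.1.bot
      · exact r.1.compatible x hxb
      · rw [if_neg hxb, add_zero] at hx
        have h1 := r.2.2 (Finsupp.mem_support_iff.2 hx.1)
        rw [vars, Finset.mem_filter] at h1
        rcases h1.2 with h2 | h2
        · omega
        · exact h2
  obtain ⟨k1, k2⟩ := key p
  obtain ⟨k1', k2'⟩ := key p'
  rw [← hU, ← hd] at k1' k2'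
  have hpar : p.1.parity = p'.1.parity := by
    have h := parity_eq_of_compatible (p.1.bot_nonempty.mono k1) k1 k1' k2 k2'
    have h1 := p.1.parity.2
    have h2 := p'.1.parity.2
    exact Fin.ext (by omega)
  rw [← hpar] at k2'
  have hbot : p.1.bot = p'.1.bot :=
    eq_of_compatible_of_parity _ _ _ k1 k1' k2 k2' (p.1.2.2.1.trans p'.1.2.2.1.symm)
  have hq : p.1 = p'.1 := Subtype.ext (Prod.ext hU (Prod.ext hpar hbot))
  obtain ⟨q, c⟩ := p
  obtain ⟨q', c'⟩ := p'
  obtain rfl : q = q' := hq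
  have hc : c = c' := Subtype.ext (add_right_cancel hd)
  rw [hc]

theorem exists_lead_eq {U : Finset (Fin n)} {d : Fin n →₀ ℕ} (hU : U.card = m)
    (hd : ∃ s ∈ d.support, ∀ u ∈ U, s < u) :
    ∃ p : Σ q : SummandIndex n m, {c : Fin n →₀ ℕ // c.support ⊆ q.vars},
      p.1.ext = U ∧ leadExponent p = d := by
  set S := d.support.filter fun x : Fin n => (x : ℕ) < minOr U with hS
  obtain ⟨s, hs, hsU⟩ := hd
  obtain ⟨p, hp⟩ := exists_compatible S
    ⟨s, Finset.mem_filter.2 ⟨hs, (lt_minOr_iff U s).2 hsU⟩⟩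
  obtain ⟨A, hAS, hAc, hodd⟩ := hp 1
  let q : SummandIndex n m := ⟨(U, p, A), hU, hodd,
    fun a ha => (Finset.mem_filter.1 (hAS ha)).2, fun a ha => hAc a (hAS ha)⟩
  have hle : squarefreeExponent A ≤ d := by
    intro i
    rw [squarefreeExponent_apply]
    split_ifs with hi
    · exact Nat.one_le_iff_ne_zero.2
        (Finsupp.mem_support_iff.1 (Finset.mem_filter.1 (hAS hi)).1)
    · exact Nat.zero_le _
  refine ⟨⟨q, d - squarefreeExponent A, ?_⟩, rfl, tsub_add_cancel_of_le hle⟩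
  intro x hx
  have hxd : x ∈ d.support := Finsupp.support_tsub hx
  refine Finset.mem_filter.2 ⟨Finset.mem_univ _, ?_⟩
  by_cases hxU : minOr U ≤ x
  · exact Or.inl hxU
  · exact Or.inr (hAc x (Finset.mem_filter.2 ⟨hxd, not_le.1 hxU⟩))

variable (K : Type*) [Field K]

/-- The generator of the summand, as an element of the Koszul algebra. -/
def koszulElement (q : SummandIndex n m) : KoszulAlgebra K n :=
  MvPolynomial.monomial (squarefreeExponent (q.bot.erase q.pivot)) (1 : K) •
    koszulDifferential K n (koszulProd K n (q.pivot :: q.ext.sort))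

theorem koszulElement_mem (q : SummandIndex n m) :
    q.koszulElement K ∈ syzygy K n (m + 1) := by
  refine Submodule.smul_mem _ _ ⟨_, ?_, rfl⟩
  have h := koszulProd_mem_exteriorPower (K := K) (q.pivot :: q.ext.sort)
  rwa [List.length_cons, Finset.length_sort, q.card_ext] at h

/-- The generator of the summand. -/
def gen (q : SummandIndex n m) : syzygy K n (m + 1) := ⟨q.koszulElement K, q.koszulElement_mem K⟩

theorem gen_homogeneous (q : SummandIndex n m) :
    ∃ a, q.gen K ∈ syzygyComponent K n (m + 1) a := by
  have h := monomial_smul_mem_koszulComponent (squarefreeExponent (q.bot.erase q.pivot))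
    (koszulDifferential_koszulProd_mem_koszulComponent (K := K) (q.pivot :: q.ext.sort))
  exact ⟨_, Submodule.mem_comap.2 h⟩

/-- In `∂(e_t ∧ e_U) = X_t e_U - e_t ∧ ∂e_U` the second part has no coordinate at a `V` without `t`.
-/
theorem koszulCoord_smul_koszulElement (q : SummandIndex n m) (c : Fin n →₀ ℕ)
    {V : Finset (Fin n)} (hV : V.card = m) (ht : q.pivot ∉ V) :
    koszulCoord K n V.sort (MvPolynomial.monomial c (1 : K) • q.koszulElement K) =
      if V = q.ext then MvPolynomial.monomial (c + squarefreeExponent q.bot) 1 else 0 := by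
  rw [koszulElement, koszulProd_cons, koszulDifferential_gen_mul, smul_smul, map_smul, map_sub,
    map_smul, koszulCoord_gen_mul_of_notMem (by simpa using ht), sub_zero,
    koszulCoord_sort_koszulProd_sort (hV.trans q.card_ext.symm), MvPolynomial.monomial_mul,
    ← squarefreeExponent_erase_add q.pivot_mem]
  split_ifs
  · rw [smul_eq_mul, smul_eq_mul, mul_one, mul_one, MvPolynomial.X, MvPolynomial.monomial_mul,
      mul_one, add_assoc]
  · simp

/-- The coefficients of an element of the syzygy module at the leading terms. -/
def leadCoeff : syzygy K n (m + 1) →ₗ[K]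
    ((Σ q : SummandIndex n m, {c : Fin n →₀ ℕ // c.support ⊆ q.vars}) → K) :=
  LinearMap.pi fun p => MvPolynomial.lcoeff K (leadExponent p) ∘ₗ
    (koszulCoord K n p.1.ext.sort).restrictScalars K ∘ₗ
    (syzygy K n (m + 1)).subtype.restrictScalars K

theorem leadCoeff_apply (y : syzygy K n (m + 1))
    (p : Σ q : SummandIndex n m, {c : Fin n →₀ ℕ // c.support ⊆ q.vars}) :
    leadCoeff K y p =
      MvPolynomial.coeff (leadExponent p) (koszulCoord K n p.1.ext.sort (y : KoszulAlgebra K n)) :=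
  rfl

/-- The monomial multiples of the generators that occur in the summands. -/
def monomialMultiple (p : Σ q : SummandIndex n m, {c : Fin n →₀ ℕ // c.support ⊆ q.vars}) :
    syzygy K n (m + 1) := MvPolynomial.monomial p.2.1 (1 : K) • p.1.gen K

theorem leadCoeff_monomialMultiple_self
    (p : Σ q : SummandIndex n m, {c : Fin n →₀ ℕ // c.support ⊆ q.vars}) :
    leadCoeff K (monomialMultiple K p) p = 1 := by
  rw [leadCoeff_apply]
  change MvPolynomial.coeff _ (koszulCoord K n p.1.ext.sort
    (MvPolynomial.monomial p.2.1 (1 : K) • p.1.koszulElement K)) = 1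
  rw [koszulCoord_smul_koszulElement K p.1 p.2.1 p.1.card_ext p.1.pivot_notMem, if_pos rfl,
    leadExponent, MvPolynomial.coeff_monomial, if_pos rfl]

/-- If the pivot `t` lies in the second set `V`, then `min V ≤ t < min U`; otherwise only the
leading term contributes, and it determines the index. -/
theorem leadCoeff_monomialMultiple_ne_zero
    (p p' : Σ q : SummandIndex n m, {c : Fin n →₀ ℕ // c.support ⊆ q.vars})
    (h : leadCoeff K (monomialMultiple K p) p' ≠ 0) :
    p' = p ∨ minOr p'.1.ext < minOr p.1.ext := by
  by_cases ht : p.1.pivot ∈ p'.1.ext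
  · right
    have h1 := p.1.lt_of_mem_bot _ p.1.pivot_mem
    have h2 := mt (lt_minOr_iff p'.1.ext p.1.pivot).1 fun h => lt_irrefl _ (h _ ht)
    omega
  · left
    rw [leadCoeff_apply] at h
    change MvPolynomial.coeff _ (koszulCoord K n p'.1.ext.sort
      (MvPolynomial.monomial p.2.1 (1 : K) • p.1.koszulElement K)) ≠ 0 at h
    rw [koszulCoord_smul_koszulElement K p.1 p.2.1 p'.1.card_ext ht] at h
    split_ifs at h with hU
    · rw [MvPolynomial.coeff_monomial] at h
      split_ifs at h with hd
      · exact eq_of_lead_eq hU hd.symm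
      · exact absurd rfl h
    · simp at h

theorem eq_zero_of_leadCoeff_eq_zero (y : syzygy K n (m + 1)) (h : leadCoeff K y = 0) :
    y = 0 := by
  apply Subtype.ext
  refine eq_zero_of_mem_syzygy y.2 fun U d hU hd => ?_
  obtain ⟨p, rfl, rfl⟩ := exists_lead_eq hU hd
  exact congr_fun h p

/-- Distinct indices have distinct leading terms, and only finitely many terms occur in `y`. -/
theorem finite_support_leadCoeff (y : syzygy K n (m + 1)) :
    (Function.support (leadCoeff K y)).Finite := by
  let f : (Σ q : SummandIndex n m, {c : Fin n →₀ ℕ // c.support ⊆ q.vars}) →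
      Finset (Fin n) × (Fin n →₀ ℕ) := fun p => (p.1.ext, leadExponent p)
  have hf : Function.Injective f := fun p p' h =>
    eq_of_lead_eq (Prod.ext_iff.1 h).1 (Prod.ext_iff.1 h).2
  let T : Set (Finset (Fin n) × (Fin n →₀ ℕ)) := ⋃ U : Finset (Fin n),
    Prod.mk U '' ((koszulCoord K n U.sort (y : KoszulAlgebra K n)).support : Set (Fin n →₀ ℕ))
  have hT : T.Finite := Set.finite_iUnion fun U => (Finset.finite_toSet _).image _
  refine (hT.preimage hf.injOn).subset fun p hp => ?_
  refine Set.mem_iUnion.2 ⟨p.1.ext, leadExponent p, ?_, rfl⟩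
  exact MvPolynomial.mem_support_iff.2 hp

end SummandIndex

end Decomposition

end StanleyKoszul

end

theorem corollary3p5 (K : Type*) [Field K] (n k : ℕ) (hk : 1 ≤ k) :
    (((n + k) / 2 : ℕ) : ℕ∞) ≤
      StanleyKoszul.stanleyDepth (StanleyKoszul.syzygyComponent K n k) := by
  obtain ⟨m, rfl⟩ := Nat.exists_eq_succ_of_ne_zero (Nat.one_le_iff_ne_zero.1 hk)
  refine StanleyKoszul.le_stanleyDepth_of_basis _
    (StanleyKoszul.SummandIndex.vars (m := m)) (StanleyKoszul.SummandIndex.gen K)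
    (StanleyKoszul.SummandIndex.gen_homogeneous K) ?_ ?_ _
    StanleyKoszul.SummandIndex.le_card_vars
  · exact StanleyKoszul.linearIndependent_of_unitriangular
      (StanleyKoszul.SummandIndex.leadCoeff K) (StanleyKoszul.SummandIndex.monomialMultiple K)
      (fun p => StanleyKoszul.minOr p.1.ext)
      (StanleyKoszul.SummandIndex.leadCoeff_monomialMultiple_self K)
      (StanleyKoszul.SummandIndex.leadCoeff_monomialMultiple_ne_zero K)
  -- The rank bound is `n + 1` because `minOr` takes the value `n` at `∅`, which occurs for `m = 0`.
  · exact StanleyKoszul.span_eq_top_of_unitriangular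
      (StanleyKoszul.SummandIndex.leadCoeff K) (StanleyKoszul.SummandIndex.monomialMultiple K)
      (fun p => StanleyKoszul.minOr p.1.ext) (n + 1)
      (StanleyKoszul.SummandIndex.leadCoeff_monomialMultiple_self K)
      (StanleyKoszul.SummandIndex.leadCoeff_monomialMultiple_ne_zero K)
      (fun p => by have := StanleyKoszul.minOr_add_card_le p.1.ext; omega)
      (StanleyKoszul.SummandIndex.eq_zero_of_leadCoeff_eq_zero K)
      (StanleyKoszul.SummandIndex.finite_support_leadCoeff K)
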